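/- Nets are indexed by $\varepsilon\in(0,1)$ and all asymptotics are as $\varepsilon\to 0$. Let $\widetilde{\mathbb C}=\mathcal E_M/\mathcal N$ be the ring of Colombeau generalized numbers, where $\mathcal E_M$ is the ring of nets $(z_\varepsilon)_\varepsilon\in\mathbb C^{(0,1)}$ with $|z_\varepsilon|=O(\varepsilon^b)$ for some $b\in\mathbb R$, and $\mathcal N$ is the ideal of the nets with $|z_\varepsilon|=O(\varepsilon^b)$ for all $b\in\mathbb R$. Let $X$ be a smooth (embedded, finite-dimensional, boundaryless) submanifold of $\mathbb R^d$. Let $\mathcal G(X)=\mathcal E_M(X)/\mathcal N(X)$ be the algebra of (special) Colombeau generalized functions on $X$. Here $\mathcal E_M(X)$ is the ring of nets $(u_\varepsilon)_\varepsilon$ of smooth functions $X\to\mathbb C$ such that for every compact $K\subseteq X$ and every $k\in\mathbb N=\{0,1,2,\dots\}$ there is $b\in\mathbb R$ such that for all smooth vector fields $\xi_1,\dots,\xi_k$ on $X$, $$\sup_{p\in K}|L_{\xi_1}\cdots L_{\xi_k}u_\varepsilon(p)|=O(\varepsilon^b),$$ where $L_\xi$ is the Lie derivative, and $\mathcal N(X)$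 is the ideal of those $(u_\varepsilon)_\varepsilon\in\mathcal E_M(X)$ with $\sup_{p\in K}|u_\varepsilon(p)|=O(\varepsilon^b)$ for every compact $K\subseteq X$ and every $b\in\mathbb R$. Let $h$ be any smooth Riemannian metric on $X$ and $d_h$ its Riemannian distance (infimum of the lengths of $C^1$ paths, equal to $\infty$ between different components). Let $\widetilde X_c$ be the set of compactly supported generalized points of $X$: the nets $(p_\varepsilon)_\varepsilon\in X^{(0,1)}$ for which there is a compact $K\subseteq X$ with $p_\varepsilon\in K$ for all small $\varepsilon$, modulo the equivalence $(p_\varepsilon)_\varepsilon\sim(q_\varepsilon)_\varepsilon$ iff $d_h(p_\varepsilon,q_\varepsilon)=O(\varepsilon^b)$ for all $b\in\mathbb R$. For $u\in\mathcal G(X)$ and $\tilde x\in\widetilde X_c$ the point value $u(\tilde x)\in\widetilde{\mathbb C}$ is the class of $(u_\varepsilon(p_\varepsilon))_\varepsilon$, for any representatives $(u_\varepsilon)_\varepsilon$ of $u$ and $(p_\varepsilon)_\varepsilon$ of $\tilde x$; it does not depend on the representatives. **Proposition.** Let $u\in\mathcal G(X)$. Then the following are equivalent: 1. $u$ is invertible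 in the ring $\mathcal G(X)$; 2. $u(\tilde x)$ is invertible in the ring $\widetilde{\mathbb C}$ for every $\tilde x\in\widetilde X_c$. -/

import Mathlib

open Filter Topology Asymptotics Manifold Bundle
open scoped ContDiff ENNReal

noncomputable section

namespace Colombeau

/-! ### Generalized numbers -/

/-- The parameter set `(0,1)` of all nets. -/
abbrev Par : Type := Set.Ioo (0 : ℝ) 1

/-- The filter "`ε → 0`" on `(0,1)`. -/
def toZero : Filter Par := comap Subtype.val (𝓝 (0 : ℝ))

theorem rpow_le_rpow_of_par (ε : Par) {a d : ℝ} (had : a ≤ d) : (ε : ℝ) ^ d ≤ (ε : ℝ) ^ a :=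
  Real.rpow_le_rpow_of_exponent_ge ε.2.1 ε.2.2.le had

theorem isBigO_rpow_of_le {a d : ℝ} (had : a ≤ d) :
    (fun ε : Par => (ε : ℝ) ^ d) =O[toZero] fun ε => (ε : ℝ) ^ a := by
  refine isBigO_of_le _ fun ε => ?_
  rw [Real.norm_of_nonneg (Real.rpow_nonneg ε.2.1.le _),
    Real.norm_of_nonneg (Real.rpow_nonneg ε.2.1.le _)]
  exact rpow_le_rpow_of_par ε had

/-- The ring of moderate nets of complex numbers: `|z_ε| = O(ε^b)` as `ε → 0` for some real `b`. -/
def moderateNets : Subring (Par → ℂ) where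
  carrier := {z | ∃ b : ℝ, z =O[toZero] fun ε => (ε : ℝ) ^ b}
  mul_mem' := by
    rintro z w ⟨b, hb⟩ ⟨c, hc⟩
    refine ⟨b + c, (hb.mul hc).congr_right fun ε => ?_⟩
    rw [Real.rpow_add ε.2.1]
  one_mem' := ⟨0, isBigO_of_le _ fun ε => by simp⟩
  add_mem' := by
    rintro z w ⟨b, hb⟩ ⟨c, hc⟩
    exact ⟨min b c, (hb.trans (isBigO_rpow_of_le (min_le_left _ _))).add
      (hc.trans (isBigO_rpow_of_le (min_le_right _ _)))⟩
  zero_mem' := ⟨0, isBigO_zero _ _⟩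
  neg_mem' := by
    rintro z ⟨b, hb⟩
    exact ⟨b, hb.neg_left⟩

/-- The ideal of negligible nets: `|z_ε| = O(ε^b)` as `ε → 0` for every real `b`. -/
def negligibleNets : Ideal moderateNets where
  carrier := {z | ∀ b : ℝ, (z : Par → ℂ) =O[toZero] fun ε => (ε : ℝ) ^ b}
  add_mem' := fun hz hw b => (hz b).add (hw b)
  zero_mem' := fun b => isBigO_zero _ _
  smul_mem' := by
    rintro ⟨z, c, hz⟩ w hw b
    refine (hz.mul (hw (b - c))).congr_right fun ε => ?_
    rw [← Real.rpow_add ε.2.1]; simp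

/-- The ring of Colombeau generalized complex numbers. -/
abbrev GenNum : Type := moderateNets ⧸ negligibleNets

/-! ### Smooth functions, vector fields, Lie derivatives -/

instance instContMDiffRingComplex : ContMDiffRing 𝓘(ℝ, ℂ) ∞ ℂ :=
  { (instContMDiffAddSelf : ContMDiffAdd 𝓘(ℝ, ℂ) ∞ ℂ) with
    contMDiff_mul := by
      rw [← modelWithCornersSelf_prod, chartedSpaceSelf_prod]
      exact contDiff_mul.contMDiff }

variable {n : ℕ} {M : Type*} [TopologicalSpace M] [ChartedSpace (EuclideanSpace ℝ (Fin n)) M]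

variable (n M) in
/-- The ring of smooth complex-valued functions on an `n`-dimensional manifold `M`. -/
abbrev SmoothFun : Type _ := C^∞⟮𝓡 n, M; 𝓘(ℝ, ℂ), ℂ⟯

/-- `sup_{p ∈ K} |w_ε(p)| = O(ε^b)` as `ε → 0`. -/
def SupIsBigO (K : Set M) (b : ℝ) (w : Par → SmoothFun n M) : Prop :=
  ∃ C : ℝ, ∀ᶠ ε in toZero, ∀ p ∈ K, ‖w ε p‖ ≤ C * (ε : ℝ) ^ b

section SupIsBigO

theorem SupIsBigO.exists_nonneg {K : Set M} {b : ℝ} {w : Par → SmoothFun n M}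
    (h : SupIsBigO K b w) :
    ∃ C : ℝ, 0 ≤ C ∧ ∀ᶠ ε in toZero, ∀ p ∈ K, ‖w ε p‖ ≤ C * (ε : ℝ) ^ b := by
  obtain ⟨C, hC⟩ := h
  refine ⟨|C|, abs_nonneg C, hC.mono fun ε h p hp => (h p hp).trans ?_⟩
  exact mul_le_mul_of_nonneg_right (le_abs_self C) (Real.rpow_nonneg ε.2.1.le _)

theorem SupIsBigO.of_le {K : Set M} {b c : ℝ} {w : Par → SmoothFun n M}
    (h : SupIsBigO K c w) (hbc : b ≤ c) : SupIsBigO K b w := by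
  obtain ⟨C, hC0, hC⟩ := h.exists_nonneg
  exact ⟨C, hC.mono fun ε h p hp => (h p hp).trans
    (mul_le_mul_of_nonneg_left (rpow_le_rpow_of_par ε hbc) hC0)⟩

theorem SupIsBigO.add {K : Set M} {b : ℝ} {w z : Par → SmoothFun n M}
    (hw : SupIsBigO K b w) (hz : SupIsBigO K b z) : SupIsBigO K b (fun ε => w ε + z ε) := by
  obtain ⟨C, hC⟩ := hw
  obtain ⟨D, hD⟩ := hz
  refine ⟨C + D, ?_⟩
  filter_upwards [hC, hD] with ε h1 h2 p hp
  rw [add_mul]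
  exact (norm_add_le (w ε p) (z ε p)).trans (add_le_add (h1 p hp) (h2 p hp))

theorem SupIsBigO.mul {K : Set M} {b c : ℝ} {w z : Par → SmoothFun n M}
    (hw : SupIsBigO K b w) (hz : SupIsBigO K c z) :
    SupIsBigO K (b + c) (fun ε => w ε * z ε) := by
  obtain ⟨C, hC0, hC⟩ := hw.exists_nonneg
  obtain ⟨D, hD0, hD⟩ := hz.exists_nonneg
  refine ⟨C * D, ?_⟩
  filter_upwards [hC, hD] with ε h1 h2 p hp
  calc ‖(w ε * z ε) p‖ = ‖w ε p‖ * ‖z ε p‖ := norm_mul (w ε p) (z ε p)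
    _ ≤ (C * (ε : ℝ) ^ b) * (D * (ε : ℝ) ^ c) :=
        mul_le_mul (h1 p hp) (h2 p hp) (norm_nonneg _)
          (mul_nonneg hC0 (Real.rpow_nonneg ε.2.1.le _))
    _ = C * D * (ε : ℝ) ^ (b + c) := by rw [Real.rpow_add ε.2.1]; ring

theorem SupIsBigO.neg {K : Set M} {b : ℝ} {w : Par → SmoothFun n M}
    (hw : SupIsBigO K b w) : SupIsBigO K b (fun ε => -w ε) := by
  obtain ⟨C, hC⟩ := hw
  exact ⟨C, hC.mono fun ε h p hp => (norm_neg (w ε p)).trans_le (h p hp)⟩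

theorem SupIsBigO.zero (K : Set M) (b : ℝ) : SupIsBigO K b (fun _ => (0 : SmoothFun n M)) :=
  ⟨0, Eventually.of_forall fun ε p _ => by
    rw [zero_mul]; exact (norm_zero (E := ℂ)).le⟩

theorem SupIsBigO.one (K : Set M) : SupIsBigO K 0 (fun _ => (1 : SmoothFun n M)) :=
  ⟨1, Eventually.of_forall fun ε p _ => by
    rw [Real.rpow_zero, mul_one]; exact (norm_one (α := ℂ)).le⟩

end SupIsBigO

variable [IsManifold (𝓡 n) ∞ M]

variable (n M) in
/-- The smooth vector fields on `M`: smooth sections of the tangent bundle. -/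
abbrev VField : Type _ :=
  Cₛ^∞⟮𝓡 n; EuclideanSpace ℝ (Fin n), (TangentSpace (𝓡 n) : M → Type _)⟯

/-- The Lie derivative of a smooth function along a vector field: `(L_ξ u)(p) = du_p(ξ_p)`. -/
def lieDeriv (ξ : VField n M) (u : SmoothFun n M) : SmoothFun n M :=
  ⟨fun p => mvfderiv (𝓡 n) u p (ξ p), by
    have h1 : ContMDiff (𝓡 n).tangent 𝓘(ℝ, ℂ).tangent ∞ (tangentMap (𝓡 n) 𝓘(ℝ, ℂ) u) :=
      u.contMDiff.contMDiff_tangentMap (by simp)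
    exact (contMDiff_snd_tangentBundle_modelSpace ℂ 𝓘(ℝ, ℂ)).comp (h1.comp ξ.contMDiff)⟩

theorem lieDeriv_add (ξ : VField n M) (u v : SmoothFun n M) :
    lieDeriv ξ (u + v) = lieDeriv ξ u + lieDeriv ξ v := by
  ext p
  have hu : MDifferentiableAt (𝓡 n) 𝓘(ℝ, ℂ) u p := u.contMDiff.mdifferentiableAt (by simp)
  have hv : MDifferentiableAt (𝓡 n) 𝓘(ℝ, ℂ) v p := v.contMDiff.mdifferentiableAt (by simp)
  have := mvfderiv_add (I := 𝓡 n) hu hv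
  change mvfderiv (𝓡 n) (⇑u + ⇑v) p (ξ p) = _
  rw [this]; rfl

theorem lieDeriv_neg (ξ : VField n M) (u : SmoothFun n M) :
    lieDeriv ξ (-u) = -lieDeriv ξ u := by
  ext p
  change mvfderiv (𝓡 n) (-⇑u) p (ξ p) = _
  rw [mvfderiv_neg]; rfl

theorem lieDeriv_mul (ξ : VField n M) (u v : SmoothFun n M) :
    lieDeriv ξ (u * v) = lieDeriv ξ u * v + u * lieDeriv ξ v := by
  ext p
  have hu : MDifferentiableAt (𝓡 n) 𝓘(ℝ, ℂ) u p := u.contMDiff.mdifferentiableAt (by simp)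
  have hv : MDifferentiableAt (𝓡 n) 𝓘(ℝ, ℂ) v p := v.contMDiff.mdifferentiableAt (by simp)
  have := (hu.hasMFDerivAt.mul hv.hasMFDerivAt).mfderiv
  change mvfderiv (𝓡 n) (⇑u * ⇑v) p (ξ p) = mvfderiv (𝓡 n) (⇑u) p (ξ p) * v p + u p * mvfderiv (𝓡 n) (⇑v) p (ξ p)
  have h2 : mvfderiv (𝓡 n) (⇑u * ⇑v) p (ξ p) = u p * mvfderiv (𝓡 n) (⇑v) p (ξ p) + v p * mvfderiv (𝓡 n) (⇑u) p (ξ p) := by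
    have := congrArg (fun L => L (ξ p)) this
    exact this
  rw [h2]; ring


/-- The iterated Lie derivative: `lieIter [ξ₁, …, ξₖ] u` is `L_{ξ₁} ⋯ L_{ξₖ} u`. -/
def lieIter (l : List (VField n M)) (u : SmoothFun n M) : SmoothFun n M :=
  l.foldr lieDeriv u

theorem lieIter_append_singleton (l : List (VField n M)) (ξ : VField n M) (u : SmoothFun n M) :
    lieIter (l ++ [ξ]) u = lieIter l (lieDeriv ξ u) := by
  simp [lieIter]

theorem lieIter_add (l : List (VField n M)) (u v : SmoothFun n M) :
    lieIter l (u + v) = lieIter l u + lieIter l v := by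
  induction l with
  | nil => rfl
  | cons ξ l ih =>
    change lieDeriv ξ (lieIter l (u + v)) = lieDeriv ξ (lieIter l u) + lieDeriv ξ (lieIter l v)
    rw [ih, lieDeriv_add]

theorem lieIter_neg (l : List (VField n M)) (u : SmoothFun n M) :
    lieIter l (-u) = -lieIter l u := by
  induction l with
  | nil => rfl
  | cons ξ l ih =>
    change lieDeriv ξ (lieIter l (-u)) = -lieDeriv ξ (lieIter l u)
    rw [ih, lieDeriv_neg]

theorem lieIter_zero (l : List (VField n M)) : lieIter l (0 : SmoothFun n M) = 0 := by
  simpa using lieIter_add l 0 0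

theorem lieIter_one (l : List (VField n M)) (hl : l ≠ []) :
    lieIter l (1 : SmoothFun n M) = 0 := by
  obtain ⟨l, ξ, rfl⟩ := List.eq_nil_or_concat l |>.resolve_left hl
  have h : lieDeriv ξ (1 : SmoothFun n M) = 0 := by
    ext p
    change mvfderiv (𝓡 n) (fun _ : M => (1 : ℂ)) p (ξ p) = 0
    rw [mvfderiv_const]; rfl
  rw [List.concat_eq_append, lieIter_append_singleton, h, lieIter_zero]

/-! ### Generalized functions -/

/-- Moderateness of a net of smooth functions: for every compact `K` and every `k ∈ ℕ` there is a
real `b` such that for all vector fields `ξ₁, …, ξₖ`,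
`sup_{p ∈ K} |L_{ξ₁} ⋯ L_{ξₖ} u_ε(p)| = O(ε^b)` as `ε → 0`. -/
def IsModerate (u : Par → SmoothFun n M) : Prop :=
  ∀ K : Set M, IsCompact K → ∀ k : ℕ, ∃ b : ℝ, ∀ l : List (VField n M), l.length = k →
    SupIsBigO K b (fun ε => lieIter l (u ε))

theorem IsModerate.exists_le {u : Par → SmoothFun n M} (hu : IsModerate u) {K : Set M}
    (hK : IsCompact K) (k : ℕ) : ∃ b : ℝ, ∀ l : List (VField n M), l.length ≤ k →
      SupIsBigO K b (fun ε => lieIter l (u ε)) := by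
  induction k with
  | zero =>
    obtain ⟨b, hb⟩ := hu K hK 0
    exact ⟨b, fun l hl => hb l (Nat.le_zero.1 hl)⟩
  | succ k ih =>
    obtain ⟨b, hb⟩ := ih
    obtain ⟨c, hc⟩ := hu K hK (k + 1)
    refine ⟨min b c, fun l hl => ?_⟩
    rcases Nat.lt_or_ge k l.length with h | h
    · exact (hc l (by omega)).of_le (min_le_right _ _)
    · exact (hb l h).of_le (min_le_left _ _)

theorem IsModerate.mul {u v : Par → SmoothFun n M} (hu : IsModerate u) (hv : IsModerate v) :
    IsModerate (u * v) := by
  intro K hK k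
  obtain ⟨b, hb⟩ := hu.exists_le hK k
  obtain ⟨c, hc⟩ := hv.exists_le hK k
  have key : ∀ l l₁ l₂ : List (VField n M), l.length + l₁.length ≤ k →
      l.length + l₂.length ≤ k →
      SupIsBigO K (b + c) (fun ε => lieIter l (lieIter l₁ (u ε) * lieIter l₂ (v ε))) := by
    intro l
    induction l using List.reverseRecOn with
    | nil =>
      intro l₁ l₂ h₁ h₂
      exact (hb l₁ (by simpa using h₁)).mul (hc l₂ (by simpa using h₂))
    | append_singleton l ξ ih =>
      intro l₁ l₂ h₁ h₂
      simp only [List.length_append, List.length_singleton] at h₁ h₂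
      simp only [lieIter_append_singleton, lieDeriv_mul, lieIter_add]
      exact (ih (ξ :: l₁) l₂ (by simp; omega) (by omega)).add
        (ih l₁ (ξ :: l₂) (by omega) (by simp; omega))
  exact ⟨b + c, fun l hl => key l [] [] (by simp [hl]) (by simp [hl])⟩

variable (n M) in
/-- The ring of moderate nets of smooth functions on `M`. -/
def moderateFuns : Subring (Par → SmoothFun n M) where
  carrier := {u | IsModerate u}
  mul_mem' := IsModerate.mul
  one_mem' := by
    intro K _ k
    refine ⟨0, fun l _ => ?_⟩
    by_cases hl : l = []
    · subst hl; exact SupIsBigO.one K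
    · change SupIsBigO K 0 (fun _ => lieIter l 1)
      rw [lieIter_one l hl]; exact SupIsBigO.zero K 0
  add_mem' := by
    intro u v hu hv K hK k
    obtain ⟨b, hb⟩ := hu K hK k
    obtain ⟨c, hc⟩ := hv K hK k
    refine ⟨min b c, fun l hl => ?_⟩
    have h := ((hb l hl).of_le (min_le_left b c)).add ((hc l hl).of_le (min_le_right b c))
    simp only [← lieIter_add] at h
    exact h
  zero_mem' := by
    intro K _ k
    refine ⟨0, fun l _ => ?_⟩
    change SupIsBigO K 0 (fun _ => lieIter l 0)
    rw [lieIter_zero]; exact SupIsBigO.zero K 0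
  neg_mem' := by
    intro u hu K hK k
    obtain ⟨b, hb⟩ := hu K hK k
    refine ⟨b, fun l hl => ?_⟩
    have h := (hb l hl).neg
    simp only [← lieIter_neg] at h
    exact h

variable (n M) in
/-- The ideal of negligible nets of smooth functions: `sup_{p ∈ K} |u_ε(p)| = O(ε^b)` as `ε → 0`
for every compact `K` and every real `b`. -/
def negligibleFuns : Ideal (moderateFuns n M) where
  carrier := {u | ∀ K : Set M, IsCompact K → ∀ b : ℝ, SupIsBigO K b (u : Par → SmoothFun n M)}
  add_mem' := fun hu hv K hK b => (hu K hK b).add (hv K hK b)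
  zero_mem' := fun K _ b => SupIsBigO.zero K b
  smul_mem' := by
    rintro ⟨u, hu⟩ v hv K hK b
    obtain ⟨c, hc⟩ := hu K hK 0
    have h := (hc [] rfl).mul (hv K hK (b - c))
    rw [add_sub_cancel] at h
    exact h

variable (n M) in
/-- The algebra of (special) Colombeau generalized functions on `M`. -/
abbrev GenFun : Type _ := moderateFuns n M ⧸ negligibleFuns n M

/-! ### Compactly supported nets of points and evaluation -/

variable (M) in
/-- A compactly supported net of points: for all small `ε` it stays in some fixed compact set. -/
def CompNet : Type _ :=
  {p : Par → M // ∃ K : Set M, IsCompact K ∧ ∀ᶠ ε in toZero, p ε ∈ K}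

/-- Evaluation of moderate nets of functions at a compactly supported net of points,
`(u_ε)_ε ↦ (u_ε(p_ε))_ε`. -/
def evalNet (p : CompNet M) : moderateFuns n M →+* moderateNets where
  toFun u := ⟨fun ε => (u : Par → SmoothFun n M) ε (p.1 ε), by
    obtain ⟨K, hK, hpK⟩ := p.2
    obtain ⟨b, hb⟩ := u.2 K hK 0
    obtain ⟨C, hC⟩ := hb [] rfl
    refine ⟨b, IsBigO.of_bound C ?_⟩
    filter_upwards [hpK, hC] with ε h1 h2
    rw [Real.norm_of_nonneg (Real.rpow_nonneg ε.2.1.le _)]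
    exact h2 _ h1⟩
  map_one' := rfl
  map_mul' _ _ := rfl
  map_zero' := rfl
  map_add' _ _ := rfl

/-- The value of a generalized function along a compactly supported net of points: the class of
`(u_ε(p_ε))_ε`. -/
def evalAt (p : CompNet M) : GenFun n M →+* GenNum :=
  Ideal.quotientMap negligibleNets (evalNet p) (by
    intro u hu b
    obtain ⟨K, hK, hpK⟩ := p.2
    obtain ⟨C, hC⟩ := hu K hK b
    refine IsBigO.of_bound C ?_
    filter_upwards [hpK, hC] with ε h1 h2
    rw [Real.norm_of_nonneg (Real.rpow_nonneg ε.2.1.le _)]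
    exact h2 _ h1)

/-! ### Local estimates along Riemannian paths -/
section RiemannianEstimates
variable [T2Space M] [RiemannianBundle (fun x : M => TangentSpace (𝓡 n) x)]
  [IsContinuousRiemannianBundle (EuclideanSpace ℝ (Fin n)) (fun x : M => TangentSpace (𝓡 n) x)]

theorem localFrameBound (x : M) : ∃ ξ : Fin n → VField n M, ∃ C : ℝ, 0 ≤ C ∧ ∀ᶠ y in 𝓝 x,
    ∀ (u : SmoothFun n M) (v : TangentSpace (𝓡 n) y),
      ‖mvfderiv (𝓡 n) u y v‖ ≤ (∑ i, ‖lieDeriv (ξ i) u y‖) * (C * ‖v‖) := by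
  set e := trivializationAt (EuclideanSpace ℝ (Fin n)) (fun x : M => TangentSpace (𝓡 n) x) x
  let b := (EuclideanSpace.basisFun (Fin n) ℝ).toBasis
  let f : SmoothBumpFunction (𝓡 n) x := Classical.arbitrary _
  have hb : e.baseSet = (chartAt (EuclideanSpace ℝ (Fin n)) x).source :=
    TangentBundle.trivializationAt_baseSet x
  have hs : ∀ i, ContMDiff (𝓡 n) (𝓡 n).tangent ∞
      (fun y => (⟨y, (⇑f • e.localFrame b i) y⟩ : TangentBundle (𝓡 n) M)) := fun i =>
    ContMDiffOn.smul_section_of_tsupport (u := e.baseSet) f.contMDiff.contMDiffOn e.open_baseSet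
      (by rw [hb]; exact f.tsupport_subset_chartAt_source)
      (e.contMDiffOn_localFrame_baseSet ∞ b i)
  obtain ⟨C, hC, hC'⟩ := eventually_norm_trivializationAt_lt (EuclideanSpace ℝ (Fin n))
    (fun x : M => TangentSpace (𝓡 n) x) x
  refine ⟨fun i => ⟨_, hs i⟩, C, hC.le, ?_⟩
  filter_upwards [hC', f.eventuallyEq_one, e.open_baseSet.mem_nhds (by rw [hb]; exact mem_chart_source _ x)]
    with y hy hfy hyb u v
  have hsum := (e.basisAt b hyb).sum_repr v
  have hL : ∀ i, lieDeriv (⟨_, hs i⟩ : VField n M) u y = mvfderiv (𝓡 n) u y (e.basisAt b hyb i) := by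
    intro i
    change mvfderiv (𝓡 n) u y ((⇑f • e.localFrame b i) y) = _
    congr 1
    have : f y = 1 := hfy
    rw [Pi.smul_apply', this, one_smul, e.localFrame_apply_of_mem_baseSet b hyb]
  have hcoef : ∀ i, ‖(e.basisAt b hyb).repr v i‖ ≤ C * ‖v‖ := by
    intro i
    have h1 : (e.basisAt b hyb).repr v i = (e.continuousLinearMapAt ℝ y v) i := by
      simp [Trivialization.basisAt, b, e.coe_linearMapAt_of_mem hyb]
    rw [h1]
    refine (PiLp.norm_apply_le _ i).trans ?_
    exact ((e.continuousLinearMapAt ℝ y).le_opNorm v).trans (by gcongr)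
  calc ‖mvfderiv (𝓡 n) u y v‖
      = ‖∑ i, (e.basisAt b hyb).repr v i • mvfderiv (𝓡 n) u y (e.basisAt b hyb i)‖ := by
        conv_lhs => rw [← hsum]
        simp only [map_sum, map_smul]
    _ ≤ ∑ i, ‖(e.basisAt b hyb).repr v i • mvfderiv (𝓡 n) u y (e.basisAt b hyb i)‖ := norm_sum_le _ _
    _ ≤ ∑ i, ‖mvfderiv (𝓡 n) u y (e.basisAt b hyb i)‖ * (C * ‖v‖) := by
        refine Finset.sum_le_sum fun i _ => ?_
        rw [norm_smul, mul_comm]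
        gcongr
        exact hcoef i
    _ = _ := by rw [Finset.sum_mul]; simp only [hL]

theorem enorm_sub_le_of_path {L : Set M} {A : NNReal} {δ : ℝ≥0∞} {p q : M} (u : SmoothFun n M)
    (hL : ∀ y, riemannianEDist (𝓡 n) p y < δ → y ∈ L)
    (hA : ∀ y ∈ L, ∀ v : TangentSpace (𝓡 n) y, ‖mvfderiv (𝓡 n) u y v‖ ≤ A * ‖v‖)
    (hpq : riemannianEDist (𝓡 n) p q < δ) :
    ‖u q - u p‖ₑ ≤ A * riemannianEDist (𝓡 n) p q := by
  have key : ∀ r, riemannianEDist (𝓡 n) p q < r → r ≤ δ → ‖u q - u p‖ₑ ≤ A * r := by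
    intro r hr hrδ
    obtain ⟨γ, h0, h1, hγ, hlen, -, -⟩ := exists_lt_locally_constant_of_riemannianEDist_lt hr zero_lt_one
    have hmem : ∀ t ∈ Set.Icc (0:ℝ) 1, γ t ∈ L := by
      intro t ht
      refine hL _ ?_
      refine (riemannianEDist_le_pathELength hγ.contMDiffOn h0 rfl ht.1).trans_lt ?_
      exact (pathELength_mono le_rfl ht.2).trans_lt (hlen.trans_le hrδ)
    have hc : ContDiffOn ℝ 1 (u ∘ γ) (Set.Icc 0 1) := by
      rw [← contMDiffOn_iff_contDiffOn]
      exact ((u.contMDiff.of_le (by simp)).comp hγ).contMDiffOn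
    have h2 := enorm_sub_le_lintegral_derivWithin_Icc_of_contDiffOn_Icc hc zero_le_one
    simp only [Function.comp_apply, h0, h1] at h2
    refine h2.trans ?_
    have h3 : ∀ t ∈ Set.Icc (0:ℝ) 1, ‖derivWithin (u ∘ γ) (Set.Icc 0 1) t‖ₑ ≤
        A * ‖mfderivWithin 𝓘(ℝ, ℝ) (𝓡 n) γ (Set.Icc 0 1) t 1‖ₑ := by
      intro t ht
      have h4 : mfderivWithin 𝓘(ℝ, ℝ) 𝓘(ℝ, ℂ) (u ∘ γ) (Set.Icc 0 1) t =
          (mfderiv (𝓡 n) 𝓘(ℝ, ℂ) u (γ t)).comp (mfderivWithin 𝓘(ℝ, ℝ) (𝓡 n) γ (Set.Icc 0 1) t) := by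
        apply mfderiv_comp_mfderivWithin
        · exact u.contMDiff.mdifferentiableAt (by simp)
        · exact (hγ.mdifferentiable one_ne_zero).mdifferentiableOn _ ht
        · rw [uniqueMDiffWithinAt_iff_uniqueDiffWithinAt]
          exact uniqueDiffOn_Icc zero_lt_one t ht
      have h5 : derivWithin (u ∘ γ) (Set.Icc 0 1) t = mvfderiv (𝓡 n) u (γ t)
          (mfderivWithin 𝓘(ℝ, ℝ) (𝓡 n) γ (Set.Icc 0 1) t 1) := by
        rw [← fderivWithin_derivWithin, ← mfderivWithin_eq_fderivWithin]
        exact congrArg (fun T => T 1) h4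
      have h6 := hA (γ t) (hmem t ht) (mfderivWithin 𝓘(ℝ, ℝ) (𝓡 n) γ (Set.Icc 0 1) t 1)
      rw [← h5] at h6
      rw [← ofReal_norm, ← ofReal_norm]
      refine (ENNReal.ofReal_le_ofReal h6).trans ?_
      refine le_of_eq ?_
      rw [ENNReal.ofReal_mul' (norm_nonneg _), ENNReal.ofReal_coe_nnreal]
    calc _ ≤ ∫⁻ t in Set.Icc (0:ℝ) 1, A * ‖mfderivWithin 𝓘(ℝ, ℝ) (𝓡 n) γ (Set.Icc 0 1) t 1‖ₑ :=
          MeasureTheory.setLIntegral_mono' measurableSet_Icc h3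
      _ = A * pathELength (𝓡 n) γ 0 1 := by
          rw [MeasureTheory.lintegral_const_mul' _ _ ENNReal.coe_ne_top,
            pathELength_eq_lintegral_mfderivWithin_Icc]
      _ ≤ A * r := by gcongr
  have h7 : Tendsto (fun r => (A : ℝ≥0∞) * r) (𝓝[>] (riemannianEDist (𝓡 n) p q))
      (𝓝 (A * riemannianEDist (𝓡 n) p q)) :=
    (ENNReal.continuous_const_mul ENNReal.coe_ne_top).continuousAt.tendsto.mono_left nhdsWithin_le_nhds
  have : (𝓝[>] (riemannianEDist (𝓡 n) p q)).NeBot := nhdsGT_neBot_of_exists_gt ⟨_, hpq⟩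
  refine ge_of_tendsto h7 ?_
  filter_upwards [Ioc_mem_nhdsGT hpq] with r hr using key r hr.1 hr.2

theorem exists_radius {K L : Set M} (hK : IsCompact K) (hKL : K ⊆ interior L) :
    ∃ δ : ℝ≥0∞, 0 < δ ∧ ∀ p ∈ K, ∀ y, riemannianEDist (𝓡 n) p y < δ → y ∈ L := by
  have : LocallyCompactSpace M := ChartedSpace.locallyCompactSpace (EuclideanSpace ℝ (Fin n)) M
  let _ : PseudoEMetricSpace M := PseudoEMetricSpace.ofRiemannianMetric (𝓡 n) M
  obtain ⟨δ, hδ, h⟩ := hK.exists_thickening_subset_open isOpen_interior hKL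
  refine ⟨ENNReal.ofReal δ, by simpa using hδ, fun p hp y hy => interior_subset (h ?_)⟩
  rw [Metric.mem_thickening_iff_exists_edist_lt]
  exact ⟨p, hp, by rw [edist_comm]; exact hy⟩


/-- Local uniformity of the differential of a moderate net, measured in the Riemannian norm. -/
theorem exists_norm_mvfderiv_le {u : Par → SmoothFun n M} (hu : IsModerate u) {L : Set M}
    (hL : IsCompact L) : ∃ b C : ℝ, 0 ≤ C ∧ ∀ᶠ ε in toZero, ∀ y ∈ L,
      ∀ v : TangentSpace (𝓡 n) y, ‖mvfderiv (𝓡 n) (u ε) y v‖ ≤ (C * (ε : ℝ) ^ b) * ‖v‖ := by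
  obtain ⟨b, hb⟩ := hu L hL 1
  refine ⟨b, ?_⟩
  let P : Set M → Prop := fun S => ∃ C : ℝ, 0 ≤ C ∧ ∀ᶠ ε in toZero, ∀ y ∈ S, y ∈ L →
      ∀ v : TangentSpace (𝓡 n) y, ‖mvfderiv (𝓡 n) (u ε) y v‖ ≤ (C * (ε : ℝ) ^ b) * ‖v‖
  have hP : P L := by
    refine hL.induction_on (p := P) ?_ ?_ ?_ ?_
    · exact ⟨0, le_rfl, Eventually.of_forall fun ε y hy => absurd hy (Set.notMem_empty y)⟩
    · rintro S T hST ⟨C, hC0, hC⟩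
      exact ⟨C, hC0, hC.mono fun ε h y hy => h y (hST hy)⟩
    · rintro S T ⟨C, hC0, hC⟩ ⟨D, hD0, hD⟩
      refine ⟨max C D, le_max_of_le_left hC0, ?_⟩
      filter_upwards [hC, hD] with ε h1 h2 y hy hyL v
      have hε := Real.rpow_nonneg ε.2.1.le b
      rcases hy with hy | hy
      · exact (h1 y hy hyL v).trans (by gcongr; exact le_max_left _ _)
      · exact (h2 y hy hyL v).trans (by gcongr; exact le_max_right _ _)
    · intro x _
      obtain ⟨ξ, C, hC0, hC⟩ := localFrameBound (n := n) x
      have hD : ∀ i, ∃ D : ℝ, 0 ≤ D ∧ ∀ᶠ ε in toZero, ∀ p ∈ L,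
          ‖lieDeriv (ξ i) (u ε) p‖ ≤ D * (ε : ℝ) ^ b := fun i => (hb [ξ i] rfl).exists_nonneg
      choose D hD0 hD using hD
      refine ⟨_, mem_nhdsWithin_of_mem_nhds hC, (∑ i, D i) * C,
        mul_nonneg (Finset.sum_nonneg fun i _ => hD0 i) hC0, ?_⟩
      filter_upwards [eventually_all.2 hD] with ε hε y hy hyL v
      refine (hy (u ε) v).trans ?_
      calc (∑ i, ‖lieDeriv (ξ i) (u ε) y‖) * (C * ‖v‖)
          ≤ (∑ i, D i * (ε : ℝ) ^ b) * (C * ‖v‖) := by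
            gcongr with i _
            exact hε i y hyL
        _ = _ := by rw [← Finset.sum_mul]; ring
  obtain ⟨C, hC0, hC⟩ := hP
  exact ⟨C, hC0, hC.mono fun ε h y hy => h y hy hy⟩

end RiemannianEstimates

/-! ### Compactly supported generalized points -/

/-- The distance `d_h` (with value `∞` on different connected components) induced by a
Riemannian metric `h` on `M`: the infimum of the lengths of `C¹` paths. -/
def riemDist (h : ContMDiffRiemannianMetric (𝓡 n) ∞ (EuclideanSpace ℝ (Fin n))
    (fun x : M => TangentSpace (𝓡 n) x)) (p q : M) : ℝ≥0∞ :=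
  letI : RiemannianBundle (fun x : M => TangentSpace (𝓡 n) x) := ⟨h.toRiemannianMetric⟩
  riemannianEDist (𝓡 n) p q

/-- Equivalence of nets of points: `d_h(p_ε, q_ε) = O(ε^b)` as `ε → 0` for every real `b`. -/
def PointEquiv (h : ContMDiffRiemannianMetric (𝓡 n) ∞ (EuclideanSpace ℝ (Fin n))
    (fun x : M => TangentSpace (𝓡 n) x)) (p q : Par → M) : Prop :=
  ∀ b : ℝ, ∃ C : ℝ, ∀ᶠ ε in toZero, riemDist h (p ε) (q ε) ≤ ENNReal.ofReal (C * (ε : ℝ) ^ b)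

/-- Equivalence of compactly supported nets of points, as a setoid. -/
def pointSetoid (h : ContMDiffRiemannianMetric (𝓡 n) ∞ (EuclideanSpace ℝ (Fin n))
    (fun x : M => TangentSpace (𝓡 n) x)) : Setoid (CompNet M) where
  r p q := PointEquiv h p.1 q.1
  iseqv := by
    let _ : RiemannianBundle (fun x : M => TangentSpace (𝓡 n) x) := ⟨h.toRiemannianMetric⟩
    refine ⟨?_, ?_, ?_⟩
    · intro p b
      refine ⟨0, Eventually.of_forall fun ε => ?_⟩
      exact (riemannianEDist_self (I := 𝓡 n)).le.trans zero_le
    · intro p q hpq b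
      obtain ⟨C, hC⟩ := hpq b
      exact ⟨C, hC.mono fun ε hε => (riemannianEDist_comm (I := 𝓡 n)).le.trans hε⟩
    · intro p q r hpq hqr b
      obtain ⟨C, hC⟩ := hpq b
      obtain ⟨D, hD⟩ := hqr b
      refine ⟨|C| + |D|, ?_⟩
      filter_upwards [hC, hD] with ε h1 h2
      have hε := Real.rpow_nonneg ε.2.1.le b
      rw [add_mul, ENNReal.ofReal_add (by positivity) (by positivity)]
      refine (riemannianEDist_triangle (I := 𝓡 n) (y := q.1 ε)).trans (add_le_add ?_ ?_)
      · refine h1.trans (ENNReal.ofReal_le_ofReal ?_)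
        gcongr; exact le_abs_self C
      · refine h2.trans (ENNReal.ofReal_le_ofReal ?_)
        gcongr; exact le_abs_self D

/-- The set of compactly supported generalized points of `M`, formed with the Riemannian
metric `h`. -/
def CompPoint (h : ContMDiffRiemannianMetric (𝓡 n) ∞ (EuclideanSpace ℝ (Fin n))
    (fun x : M => TangentSpace (𝓡 n) x)) : Type _ :=
  Quotient (pointSetoid h)

theorem tendsto_rpow_toZero {b : ℝ} (hb : 0 < b) (C : ℝ) :
    Tendsto (fun ε : Par => C * (ε : ℝ) ^ b) toZero (𝓝 0) := by
  have h1 : Tendsto (fun x : ℝ => x ^ b) (𝓝 0) (𝓝 0) := by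
    simpa [Real.zero_rpow hb.ne'] using (Real.continuousAt_rpow_const 0 b (Or.inr hb.le)).tendsto
  have h2 : Tendsto (fun ε : Par => (ε : ℝ) ^ b) toZero (𝓝 0) := h1.comp tendsto_comap
  simpa using h2.const_mul C

/-- The class of `(u_ε(p_ε))_ε` does not depend on the representative `(p_ε)_ε`. -/
theorem evalAt_eq [T2Space M] (h : ContMDiffRiemannianMetric (𝓡 n) ∞ (EuclideanSpace ℝ (Fin n))
    (fun x : M => TangentSpace (𝓡 n) x)) (u : GenFun n M) {p q : CompNet M}
    (hpq : PointEquiv h p.1 q.1) : evalAt p u = evalAt q u := by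
  let _ : RiemannianBundle (fun x : M => TangentSpace (𝓡 n) x) := ⟨h.toRiemannianMetric⟩
  have : IsContMDiffRiemannianBundle (𝓡 n) ∞ (EuclideanSpace ℝ (Fin n))
      (fun x : M => TangentSpace (𝓡 n) x) := inferInstance
  have : IsContinuousRiemannianBundle (EuclideanSpace ℝ (Fin n))
      (fun x : M => TangentSpace (𝓡 n) x) :=
    ⟨⟨h.inner, h.contMDiff.continuous, fun _ _ _ => rfl⟩⟩
  have : LocallyCompactSpace M := ChartedSpace.locallyCompactSpace (EuclideanSpace ℝ (Fin n)) M
  obtain ⟨u, rfl⟩ := Ideal.Quotient.mk_surjective u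
  obtain ⟨K, hK, hpK⟩ := p.2
  obtain ⟨L, hL, hKL⟩ := exists_compact_superset hK
  obtain ⟨b, C, hC0, hC⟩ := exists_norm_mvfderiv_le (n := n) u.2 hL
  obtain ⟨δ, hδ, hδL⟩ := exists_radius (n := n) hK hKL
  refine Ideal.Quotient.eq.2 fun c => ?_
  obtain ⟨D, hD⟩ := hpq (c - b)
  obtain ⟨D', hD'⟩ := hpq 1
  have hsmall : ∀ᶠ ε : Par in toZero, ENNReal.ofReal (D' * (ε : ℝ) ^ (1 : ℝ)) < δ := by
    have h1 := (ENNReal.continuous_ofReal.tendsto 0).comp (tendsto_rpow_toZero one_pos D')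
    rw [ENNReal.ofReal_zero] at h1
    exact h1.eventually_lt_const hδ
  refine IsBigO.of_bound (C * |D|) ?_
  filter_upwards [hpK, hC, hD, hD', hsmall] with ε h1 h2 h3 h4 h5
  have hεb := Real.rpow_nonneg ε.2.1.le b
  have hεc := Real.rpow_nonneg ε.2.1.le (c - b)
  have key := enorm_sub_le_of_path (n := n) (A := ⟨C * (ε : ℝ) ^ b, by positivity⟩)
    ((u : Par → SmoothFun n M) ε) (fun y hy => hδL _ h1 y hy) (fun y hy v => h2 y hy v)
    (h4.trans_lt h5)
  have key2 : ‖(u : Par → SmoothFun n M) ε (q.1 ε) - (u : Par → SmoothFun n M) ε (p.1 ε)‖ₑ ≤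
      ENNReal.ofReal (C * (ε : ℝ) ^ b) * ENNReal.ofReal (|D| * (ε : ℝ) ^ (c - b)) := by
    refine key.trans (mul_le_mul' ?_ (h3.trans (ENNReal.ofReal_le_ofReal ?_)))
    · exact (ENNReal.ofReal_eq_coe_nnreal (by positivity)).ge
    · gcongr; exact le_abs_self D
  rw [← ofReal_norm, ← ENNReal.ofReal_mul (by positivity),
    ENNReal.ofReal_le_ofReal_iff (by positivity)] at key2
  rw [Real.norm_of_nonneg (Real.rpow_nonneg ε.2.1.le _)]
  change ‖(u : Par → SmoothFun n M) ε (p.1 ε) - (u : Par → SmoothFun n M) ε (q.1 ε)‖ ≤ _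
  rw [norm_sub_rev]
  refine key2.trans (le_of_eq ?_)
  have : (ε : ℝ) ^ c = (ε : ℝ) ^ b * (ε : ℝ) ^ (c - b) := by
    rw [← Real.rpow_add ε.2.1]; simp
  rw [this]; ring

/-- The point value `u(x) ∈ ℂ̃` of a generalized function at a compactly supported generalized
point: the class of `(u_ε(p_ε))_ε` for any representatives. -/
def pointValue [T2Space M] {h : ContMDiffRiemannianMetric (𝓡 n) ∞ (EuclideanSpace ℝ (Fin n))
    (fun x : M => TangentSpace (𝓡 n) x)} (u : GenFun n M) (x : CompPoint h) : GenNum :=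
  Quotient.liftOn x (fun p => evalAt p u) fun _ _ hpq => evalAt_eq h u hpq

end Colombeau

end

noncomputable section

namespace Colombeau

/-! ### Invertible generalized numbers -/

/-! Evaluation along a compactly supported net is a ring homomorphism, so invertibility passes from
`u` to its point values. The content is the converse.

Given a compact `K`, let `p_ε ∈ K` be a point where `|u_ε|` is minimal on `K`. The value of `u` at
this single generalized point is invertible, and an invertible generalized number is bounded below
by a power of `ε`; by minimality the bound holds on all of `K` (`exists_one_le_on_compact`).

The pointwise reciprocal of `u_ε` need not exist, since the threshold for `ε` depends on `K` and
`u_ε` may vanish outside `K`. Instead of gluing local inverses, put `v_ε = conj u_ε / (|u_ε|² +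
r_ε)` with `r_ε = ε^(1/ε) > 0`, which is smooth on the whole manifold for every `ε`. The lower bound
controls the denominator from below on each compact set, and induction on the order of
differentiation then makes `v` moderate (`exists_lieBound_recip`). Finally `u_ε v_ε - 1 = -r_ε /
(|u_ε|² + r_ε)` is negligible, because `r_ε` decays faster than every power of `ε`
(`isUnit_mk_of_one_le`). -/

theorem exists_one_le_of_isUnit {z : moderateNets}
    (hz : IsUnit (Ideal.Quotient.mk negligibleNets z)) :
    ∃ m C : ℝ, 0 ≤ C ∧ ∀ᶠ ε : Par in toZero, 1 ≤ C * (ε : ℝ) ^ m * ‖(z : Par → ℂ) ε‖ := by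
  obtain ⟨w, hw⟩ := isUnit_iff_exists_inv.1 hz
  obtain ⟨⟨w, b, hb⟩, rfl⟩ := Ideal.Quotient.mk_surjective w
  have hneg : ∀ b : ℝ, (fun ε => (z : Par → ℂ) ε * w ε - 1) =O[toZero]
      fun ε : Par => (ε : ℝ) ^ b := Ideal.Quotient.eq.1 hw
  obtain ⟨C, hC0, hC⟩ := hb.exists_nonneg
  obtain ⟨D, hD⟩ := (hneg 1).bound
  have hsmall : ∀ᶠ ε : Par in toZero, D * (ε : ℝ) ^ (1 : ℝ) < 1 / 2 :=
    (tendsto_rpow_toZero one_pos D).eventually_lt_const (by norm_num)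
  -- Once `|zw - 1| < 1/2`, one has `|z||w| > 1/2`; combined with `|w| ≤ C ε^b` this gives `2C ε^b
  -- |z| ≥ 1`.
  refine ⟨b, 2 * C, by positivity, ?_⟩
  filter_upwards [hC.bound, hD, hsmall] with ε h1 h2 h3
  rw [Real.norm_of_nonneg (Real.rpow_nonneg ε.2.1.le _)] at h1 h2
  have h4 : 1 - ‖(z : Par → ℂ) ε * w ε‖ ≤ ‖(z : Par → ℂ) ε * w ε - 1‖ := by
    have := norm_sub_norm_le (1 : ℂ) ((z : Par → ℂ) ε * w ε)
    rwa [norm_one, norm_sub_rev] at this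
  rw [norm_mul] at h4
  have h5 := mul_le_mul_of_nonneg_left h1 (norm_nonneg ((z : Par → ℂ) ε))
  linarith

variable {n : ℕ} {M : Type*} [TopologicalSpace M] [ChartedSpace (EuclideanSpace ℝ (Fin n)) M]

/-- If the values of a net of smooth functions along all compactly supported nets of points are
invertible, then the net is bounded below by a power of `ε`, uniformly on compact sets. -/
theorem exists_one_le_on_compact [IsManifold (𝓡 n) ∞ M] (u : moderateFuns n M)
    (hu : ∀ p : CompNet M, IsUnit (Ideal.Quotient.mk negligibleNets (evalNet p u)))
    {K : Set M} (hK : IsCompact K) :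
    ∃ m C : ℝ, 0 ≤ C ∧ ∀ᶠ ε : Par in toZero, ∀ p ∈ K,
      1 ≤ C * (ε : ℝ) ^ m * ‖(u : Par → SmoothFun n M) ε p‖ := by
  rcases K.eq_empty_or_nonempty with rfl | hne
  · exact ⟨0, 0, le_rfl, Eventually.of_forall fun ε p hp => absurd hp (Set.notMem_empty p)⟩
  -- The minimizers are chosen separately for each `ε`; nets of points need no regularity in `ε`.
  choose p hpK hp using fun ε : Par => hK.exists_isMinOn hne
    ((u : Par → SmoothFun n M) ε).contMDiff.continuous.norm.continuousOn
  obtain ⟨m, C, hC0, hC⟩ :=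
    exists_one_le_of_isUnit (hu ⟨p, K, hK, Eventually.of_forall hpK⟩)
  refine ⟨m, C, hC0, hC.mono fun ε hε q hq => hε.trans ?_⟩
  have hεm := Real.rpow_nonneg ε.2.1.le m
  exact mul_le_mul_of_nonneg_left (hp ε hq) (by positivity)

/-! ### Conjugates, constants and reciprocals of smooth functions -/

/-- The complex conjugate of a smooth function. -/
def SmoothFun.conj (u : SmoothFun n M) : SmoothFun n M :=
  ⟨fun p => starRingEnd ℂ (u p), Complex.conjCLE.contDiff.contMDiff.comp u.contMDiff⟩

/-- A constant smooth function. -/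
def SmoothFun.const (c : ℂ) : SmoothFun n M := ⟨fun _ => c, contMDiff_const⟩

/-- The reciprocal of a nowhere vanishing smooth function. -/
def SmoothFun.recip (g : SmoothFun n M) (hg : ∀ p, g p ≠ 0) : SmoothFun n M :=
  ⟨fun p => (g p)⁻¹, fun p =>
    ((contDiffAt_inv ℝ (hg p)).contMDiffAt (n := ∞)).comp p g.contMDiff.contMDiffAt⟩

/-- The regularization `|u|² + r` of the squared absolute value of a smooth function. -/
def regNormSq (r : ℝ) (u : SmoothFun n M) : SmoothFun n M := u.conj * u + SmoothFun.const r

theorem regNormSq_apply (r : ℝ) (u : SmoothFun n M) (p : M) :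
    regNormSq r u p = ((‖u p‖ ^ 2 + r : ℝ) : ℂ) := by
  change starRingEnd ℂ (u p) * u p + (r : ℂ) = _
  rw [Complex.conj_mul']; push_cast; rfl

theorem regNormSq_ne_zero {r : ℝ} (hr : 0 < r) (u : SmoothFun n M) (p : M) :
    regNormSq r u p ≠ 0 := by
  rw [regNormSq_apply, Complex.ofReal_ne_zero]
  positivity

variable [IsManifold (𝓡 n) ∞ M]

theorem lieDeriv_conj (ξ : VField n M) (u : SmoothFun n M) :
    lieDeriv ξ u.conj = (lieDeriv ξ u).conj := by
  ext p
  have hu : MDifferentiableAt (𝓡 n) 𝓘(ℝ, ℂ) u p := u.contMDiff.mdifferentiableAt (by simp)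
  have h := (Complex.conjCLE.hasFDerivAt.hasMFDerivAt.comp p hu.hasMFDerivAt).mfderiv
  exact congrArg (fun L => L (ξ p)) h

theorem lieIter_conj (l : List (VField n M)) (u : SmoothFun n M) :
    lieIter l u.conj = (lieIter l u).conj := by
  induction l with
  | nil => rfl
  | cons ξ l ih => exact (congrArg (lieDeriv ξ) ih).trans (lieDeriv_conj ξ _)

theorem lieDeriv_const (ξ : VField n M) (c : ℂ) :
    lieDeriv ξ (SmoothFun.const c : SmoothFun n M) = 0 := by
  ext p
  change mvfderiv (𝓡 n) (fun _ : M => c) p (ξ p) = 0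
  rw [mvfderiv_const]; rfl

/-- Differentiate `g⁻¹ * g = 1` by the Leibniz rule and multiply by `g⁻¹`. In this form the order-`k
+ 1` bounds for `g⁻¹` need only order-`k` bounds for `g⁻¹` and for the derivatives of `g`. -/
theorem lieDeriv_recip (ξ : VField n M) (g : SmoothFun n M) (hg : ∀ p, g p ≠ 0) :
    lieDeriv ξ (g.recip hg) = -(g.recip hg * g.recip hg * lieDeriv ξ g) := by
  have h1 : g.recip hg * g = 1 := by
    ext p; exact inv_mul_cancel₀ (hg p)
  have h2 : lieDeriv ξ (g.recip hg) * g + g.recip hg * lieDeriv ξ g = 0 := by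
    rw [← lieDeriv_mul, h1]; exact lieIter_one [ξ] (by simp)
  linear_combination g.recip hg * h2 - lieDeriv ξ (g.recip hg) * h1

/-! ### Uniform estimates for Lie derivatives up to a given order -/

/-- All iterated Lie derivatives of `u_ε` of order at most `k` are `O(ε^b)` on `K`. -/
def LieBound (K : Set M) (k : ℕ) (b : ℝ) (u : Par → SmoothFun n M) : Prop :=
  ∀ l : List (VField n M), l.length ≤ k → SupIsBigO K b fun ε => lieIter l (u ε)

namespace LieBound

variable {K : Set M} {k : ℕ} {b c : ℝ} {u v : Par → SmoothFun n M}

theorem of_le (h : LieBound K k c u) (hbc : b ≤ c) : LieBound K k b u :=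
  fun l hl => (h l hl).of_le hbc

theorem neg (h : LieBound K k b u) : LieBound K k b fun ε => -u ε := by
  intro l hl
  simp only [lieIter_neg]
  exact (h l hl).neg

theorem conj (h : LieBound K k b u) : LieBound K k b fun ε => (u ε).conj := by
  intro l hl
  obtain ⟨C, hC⟩ := h l hl
  refine ⟨C, hC.mono fun ε hε p hp => ?_⟩
  change ‖lieIter l (u ε).conj p‖ ≤ _
  rw [lieIter_conj]
  exact (RCLike.norm_conj _).trans_le (hε p hp)

theorem lieDeriv (h : LieBound K (k + 1) b u) (ξ : VField n M) :
    LieBound K k b fun ε => lieDeriv ξ (u ε) := by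
  intro l hl
  have := h (l ++ [ξ]) (by simpa using hl)
  simpa only [lieIter_append_singleton] using this

/-- The innermost field is the last in the list, so splitting it off leaves a shorter list acting on
`L_ξ u`. The exponent `b` is common to all fields `ξ`, while the implied constants may depend on
them. -/
theorem succ (h0 : SupIsBigO K b u) (h : ∀ ξ, LieBound K k b fun ε => Colombeau.lieDeriv ξ (u ε)) :
    LieBound K (k + 1) b u := by
  intro l hl
  rcases List.eq_nil_or_concat l with rfl | ⟨l, ξ, rfl⟩
  · exact h0
  · simp only [List.concat_eq_append, lieIter_append_singleton]
    exact h ξ l (by simpa using hl)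

/-- One exponent serves all orders up to `k`, so every term of the Leibniz expansion is `O(ε^(b +
c))` and the exponent does not degrade in the induction. -/
theorem mul (hu : LieBound K k b u) (hv : LieBound K k c v) :
    LieBound K k (b + c) fun ε => u ε * v ε := by
  induction k generalizing u v with
  | zero =>
    intro l hl
    obtain rfl := List.length_eq_zero_iff.1 (Nat.le_zero.1 hl)
    exact (hu [] le_rfl).mul (hv [] le_rfl)
  | succ k ih =>
    refine succ ((hu [] (by simp)).mul (hv [] (by simp))) fun ξ l hl => ?_
    simp only [lieDeriv_mul, lieIter_add]
    exact (ih (hu.lieDeriv ξ) (fun l hl => hv l (by omega)) l hl).add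
      (ih (fun l hl => hu l (by omega)) (hv.lieDeriv ξ) l hl)

end LieBound

/-- Reciprocals of nets satisfying moderate estimates are moderate where they are bounded by a
power of `ε`. -/
theorem exists_lieBound_recip {K : Set M} {g : Par → SmoothFun n M} (hg : ∀ ε p, g ε p ≠ 0)
    {c : ℝ} (h0 : SupIsBigO K c fun ε => (g ε).recip (hg ε))
    (h : ∀ k, ∃ b, ∀ ξ, LieBound K k b fun ε => lieDeriv ξ (g ε)) (k : ℕ) :
    ∃ b, LieBound K k b fun ε => (g ε).recip (hg ε) := by
  induction k with
  | zero =>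
    refine ⟨c, fun l hl => ?_⟩
    obtain rfl := List.length_eq_zero_iff.1 (Nat.le_zero.1 hl)
    exact h0
  | succ k ih =>
    obtain ⟨a, ha⟩ := ih
    obtain ⟨b, hb⟩ := h k
    -- `c` serves order zero; `a + a + b` is the exponent of `g⁻¹ * g⁻¹ * L_ξ g`.
    refine ⟨min c (a + a + b), .succ (h0.of_le (min_le_left _ _)) fun ξ => ?_⟩
    simp only [lieDeriv_recip]
    exact ((ha.mul ha).mul (hb ξ)).neg.of_le (min_le_right _ _)

/-! ### Inversion of generalized functions -/

/-- A positive net that is smaller than every power of `ε`. -/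
def rapidNet (ε : Par) : ℝ := (ε : ℝ) ^ (ε : ℝ)⁻¹

theorem rapidNet_pos (ε : Par) : 0 < rapidNet ε := Real.rpow_pos_of_pos ε.2.1 _

/-- As `ε < 1`, it suffices that the exponent `1/ε` exceeds `b`, which holds once `|b| ε < 1`. -/
theorem eventually_rapidNet_le (b : ℝ) : ∀ᶠ ε in toZero, rapidNet ε ≤ (ε : ℝ) ^ b := by
  have h : ∀ᶠ ε : Par in toZero, |b| * (ε : ℝ) ^ (1 : ℝ) < 1 :=
    (tendsto_rpow_toZero one_pos |b|).eventually_lt_const one_pos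
  filter_upwards [h] with ε hε
  rw [Real.rpow_one] at hε
  refine rpow_le_rpow_of_par ε ((le_abs_self b).trans ?_)
  rw [← one_div, le_div_iff₀ ε.2.1]
  exact hε.le

/-- A generalized function is invertible if a representative is bounded below by a power of `ε`
on every compact set. -/
theorem isUnit_mk_of_one_le (u : moderateFuns n M)
    (hu : ∀ K : Set M, IsCompact K → ∃ m C : ℝ, 0 ≤ C ∧ ∀ᶠ ε : Par in toZero, ∀ p ∈ K,
      1 ≤ C * (ε : ℝ) ^ m * ‖(u : Par → SmoothFun n M) ε p‖) :
    IsUnit (Ideal.Quotient.mk (negligibleFuns n M) u) := by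
  obtain ⟨u, hmod⟩ := u
  simp only at hu
  let g : Par → SmoothFun n M := fun ε => regNormSq (rapidNet ε) (u ε)
  have hg : ∀ ε p, g ε p ≠ 0 := fun ε => regNormSq_ne_zero (rapidNet_pos ε) (u ε)
  let w : Par → SmoothFun n M := fun ε => (g ε).recip (hg ε)
  have hw0 : ∀ K : Set M, IsCompact K → ∃ c, SupIsBigO K c w := by
    intro K hK
    obtain ⟨m, C, hC0, hC⟩ := hu K hK
    -- The denominator dominates `|u_ε|²`, so the lower bound for `|u_ε|` enters squared.
    refine ⟨m + m, C ^ 2, hC.mono fun ε hε p hp => ?_⟩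
    have h1 := hε p hp
    have hr := rapidNet_pos ε
    change ‖(regNormSq (rapidNet ε) (u ε) p)⁻¹‖ ≤ _
    rw [regNormSq_apply, norm_inv, Complex.norm_real, Real.norm_of_nonneg (by positivity),
      inv_le_iff_one_le_mul₀ (by positivity), Real.rpow_add ε.2.1]
    have hεm := Real.rpow_nonneg ε.2.1.le m
    calc (1 : ℝ) ≤ (C * (ε : ℝ) ^ m * ‖u ε p‖) ^ 2 := one_le_pow₀ h1
      _ = C ^ 2 * ((ε : ℝ) ^ m * (ε : ℝ) ^ m) * ‖u ε p‖ ^ 2 := by ring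
      _ ≤ C ^ 2 * ((ε : ℝ) ^ m * (ε : ℝ) ^ m) * (‖u ε p‖ ^ 2 + rapidNet ε) := by
        gcongr; linarith
  have hlie : ∀ K : Set M, IsCompact K → ∀ k, ∃ b, ∀ ξ,
      LieBound K k b fun ε => lieDeriv ξ (g ε) := by
    intro K hK k
    obtain ⟨b, hb⟩ := hmod.exists_le hK (k + 1)
    have hb' : LieBound K (k + 1) b u := hb
    refine ⟨b + b, fun ξ => ?_⟩
    -- The regularizing term is constant on the manifold for each `ε`, so differentiation removes it
    -- and only the moderateness of `u` matters.
    have h : ∀ ε, lieDeriv ξ (g ε) = lieDeriv ξ ((u ε).conj * u ε) := fun ε => by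
      rw [show g ε = (u ε).conj * u ε + SmoothFun.const (rapidNet ε) from rfl, lieDeriv_add,
        lieDeriv_const, add_zero]
    simp only [h]
    exact (hb'.conj.mul hb').lieDeriv ξ
  have hv : IsModerate fun ε => (u ε).conj * w ε := by
    intro K hK k
    obtain ⟨c, hc⟩ := hw0 K hK
    obtain ⟨a, ha⟩ := exists_lieBound_recip hg hc (hlie K hK) k
    obtain ⟨b, hb⟩ := hmod.exists_le hK k
    have hb' : LieBound K k b u := hb
    exact ⟨b + a, fun l hl => (hb'.conj.mul ha) l hl.le⟩
  refine isUnit_iff_exists_inv.2 ⟨Ideal.Quotient.mk _ ⟨_, hv⟩, ?_⟩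
  rw [← map_mul]
  refine Ideal.Quotient.eq.2 fun K hK b => ?_
  obtain ⟨c, hc⟩ := hw0 K hK
  obtain ⟨C, hC0, hC⟩ := hc.exists_nonneg
  refine ⟨C, ?_⟩
  -- The power `b - c` compensates the growth `ε^c` of the reciprocal, leaving `ε^b` for the error.
  filter_upwards [hC, eventually_rapidNet_le (b - c)] with ε h1 h2 p hp
  have hdiff : u ε p * (starRingEnd ℂ (u ε p) * w ε p) - 1 = -(rapidNet ε * w ε p) := by
    have h3 : (starRingEnd ℂ (u ε p) * u ε p + (rapidNet ε : ℂ)) * w ε p = 1 :=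
      mul_inv_cancel₀ (hg ε p)
    linear_combination h3
  change ‖u ε p * (starRingEnd ℂ (u ε p) * w ε p) - 1‖ ≤ _
  rw [hdiff, norm_neg, norm_mul, Complex.norm_real, Real.norm_of_nonneg (rapidNet_pos ε).le]
  calc rapidNet ε * ‖w ε p‖ ≤ (ε : ℝ) ^ (b - c) * (C * (ε : ℝ) ^ c) :=
        mul_le_mul h2 (h1 p hp) (norm_nonneg _) (Real.rpow_nonneg ε.2.1.le _)
    _ = C * ((ε : ℝ) ^ (b - c) * (ε : ℝ) ^ c) := by ring
    _ = C * (ε : ℝ) ^ b := by rw [← Real.rpow_add ε.2.1, sub_add_cancel]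

end Colombeau

end

theorem mainTheorem5 {d n : ℕ} (X : Set (EuclideanSpace ℝ (Fin d)))
    [ChartedSpace (EuclideanSpace ℝ (Fin n)) X] [IsManifold (𝓡 n) ∞ X]
    (hX : IsSmoothEmbedding (𝓡 n) (𝓡 d) ∞ (Subtype.val : X → EuclideanSpace ℝ (Fin d)))
    (h : ContMDiffRiemannianMetric (𝓡 n) ∞ (EuclideanSpace ℝ (Fin n))
      (fun x : X => TangentSpace (𝓡 n) x))
    (u : Colombeau.GenFun n X) :
    IsUnit u ↔ ∀ x : Colombeau.CompPoint h, IsUnit (Colombeau.pointValue u x) := by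
  constructor
  · intro hu x
    induction x using Quotient.inductionOn with
    | h p => exact hu.map (Colombeau.evalAt p)
  · intro hx
    obtain ⟨u, rfl⟩ := Ideal.Quotient.mk_surjective u
    exact Colombeau.isUnit_mk_of_one_le u fun K hK =>
      Colombeau.exists_one_le_on_compact u
        -- The point value at the class of `p` unfolds definitionally to the class of `evalNet p u`.
        (fun p => hx (Quotient.mk (Colombeau.pointSetoid h) p)) hK
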